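/- Let $p$ be an odd prime and $X=\mathbb{Z}_p\times\mathbb{Z}/(p-1)\mathbb{Z}$. Let $\omega$ be the Teichmüller character modulo $p$, with values in $\mathbb{Z}_p\subset\mathbb{C}_p$; a Dirichlet character $\chi$ modulo $p^v$ ($v\ge 1$) is extended to $\mathbb{Z}_p$ by continuity (so $\omega^0$ is the trivial character modulo $p$, which vanishes on $p\mathbb{Z}_p$). For $0\neq a\in\mathbb{Z}_p$ with $a=p^{r}a'$ and $a'\in\mathbb{Z}_p^\times$, put $\langle a\rangle=a'/\omega(a')$, and $\langle a\rangle^{z}=\sum_{n\ge0}\binom{z}{n}(\langle a\rangle-1)^n$. * Cohen's $p$-adic Hurwitz zeta function is, for $x\in\mathbb{Z}_p$, $z\in\mathbb{C}_p$, $|z|_p<p^{(p-2)/(p-1)}$, $z\ne1$, $$\zeta_p(z,\chi,x)=\frac1{z-1}\int_{\mathbb{Z}_p}\chi(x+a)\langle x+a\rangle^{1-z}\,da,\qquad \int_{\mathbb{Z}_p}f(a)\,da=\lim_{N\to\infty}\frac1{p^N}\sum_{a=0}^{p^N-1}f(a),$$ where $\chi(0)\langle 0\rangle^{1-z}$ is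 read as $0$; $\zeta_p(1,\chi,x)$ is the limit as $z\to1$ when this limit exists. The extended constant term is $a_0(z,\chi,x)=\tfrac12\zeta_p(1-z,\chi,x)$. * Iwasawa's $p$-adic $L$-function is $L_p(z,\chi)=\frac{1}{z-1}A_\chi(1-z)$ for $z\neq1$, where, with $\chi_n$ the primitive character attached to $\chi\omega^{-n}$ and $b_n=(1-\chi_n(p)p^{n-1})B_{n,\chi_n}$ ($B_{n,\chi_n}$ the generalized Bernoulli numbers), $A_\chi(t)=\sum_{n\ge0}c_n\binom tn$ and $c_n=\sum_{i=0}^n(-1)^{n-i}\binom ni b_i$, so that $A_\chi(n)=b_n$ for all $n\ge0$; $L_p(1,\chi)$ is the limit as $z\to1$ when this limit exists. * For $(s,u)\in X$ with $u$ even and $(s,u)\ne(0,0)$, Serre's $p$-adic Eisenstein series $G^*_{s,u}$ is the coefficientwise limit of the $q$-expansions $G_k=-\frac{B_k}{2k}+\sum_{n\ge1}\sigma_{k-1}(n)q^n$ as $k\to\infty$ through even positive integers with $k\to(s,u)$ in $X$, and $a_0(G^*_{s,u})$ is its constant term. **Proposition.** For every $(s,u)\in X$ with $u$ even and $(s,u)\neq(0,0)$,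 $$a_0(s,\omega^u,0)=\tfrac12\zeta_p(1-s,\omega^u,0)=a_0(G^*_{s,u})=\tfrac12L_p(1-s,\omega^u).$$ In particular the limit defining $a_0(G^*_{s,u})$ exists. For $s\neq0$, the binomial series $\langle a\rangle^{s}$ ($0\ne a\in\mathbb{Z}_p$), the integral defining $\zeta_p(1-s,\omega^u,0)$ and the series $A_{\omega^u}(s)$ converge. For $s=0$ (so $u\neq0$), the limits of $\zeta_p(z,\omega^u,0)$ and $L_p(z,\omega^u)$ as $z\to1$ in $\mathbb{C}_p$ exist. -/

import Mathlib

open Filter Topology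

noncomputable section

namespace PadicEisenstein

variable (p : ℕ) [Fact p.Prime]

/-! ### Characters and the projection `⟨·⟩` (for an odd prime `p`) -/

/-- The Teichmüller lift of `a` modulo `p`: `0` for `a = 0`, and otherwise the root of unity of
order prime to `p` in `ℤ_p` congruent to `a`. -/
def teichmullerLift : ZMod p →* ℤ_[p] :=
  ((WittVector.equiv p : WittVector p (ZMod p) ≃+* ℤ_[p]) :
    WittVector p (ZMod p) →* ℤ_[p]).comp (WittVector.teichmuller p)

theorem toZMod_teichmullerLift (a : ZMod p) : PadicInt.toZMod (teichmullerLift p a) = a := by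
  have key (f : ℤ_[p] →+* ZMod p) (x : ℤ_[p]) : f x = (x.zmodRepr : ZMod p) := by
    have hx := PadicInt.sub_zmodRepr_mem x
    rw [PadicInt.maximalIdeal_eq_span_p] at hx
    obtain ⟨y, hy⟩ := Ideal.mem_span_singleton.mp hx
    have h : f (x - x.zmodRepr) = f (p * y) := congrArg f hy
    rw [map_sub, map_mul, map_natCast, map_natCast, ZMod.natCast_self, zero_mul] at h
    exact sub_eq_zero.mp h
  have h := key ((WittVector.constantCoeff (p := p) (R := ZMod p)).comp
    ((WittVector.equiv p).symm : ℤ_[p] →+* WittVector p (ZMod p))) (teichmullerLift p a)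
  rw [key, ← h]
  simp [teichmullerLift]

theorem teichmullerLift_zero : teichmullerLift p 0 = 0 := by
  simp [teichmullerLift]

/-- The Teichmüller character `ω`, as a character modulo `p` with values in `ℂ_p`. -/
def teichmullerChar : DirichletCharacter ℂ_[p] p where
  toFun a := algebraMap ℚ_[p] ℂ_[p] (teichmullerLift p a : ℚ_[p])
  map_one' := by simp
  map_mul' a b := by simp
  map_nonunit' a ha := by
    have h : a = 0 := by
      by_contra h
      exact ha (isUnit_iff_ne_zero.mpr h)
    simp [h, teichmullerLift_zero]

/-- The Teichmüller character `ω`, regarded as a character modulo `p ^ (v + 1)`. -/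
def omega (v : ℕ) : DirichletCharacter ℂ_[p] (p ^ (v + 1)) :=
  DirichletCharacter.changeLevel (dvd_pow_self p (Nat.succ_ne_zero v)) (teichmullerChar p)

variable {p}

/-- The extension to `ℤ_p` of a Dirichlet character modulo a positive power of `p`. -/
def extendChar {v : ℕ} (χ : DirichletCharacter ℂ_[p] (p ^ (v + 1))) (a : ℤ_[p]) : ℂ_[p] :=
  χ (PadicInt.toZModPow (v + 1) a)

open Classical in
/-- `⟨a⟩ = p ^ (-v_p(a)) a / ω(p ^ (-v_p(a)) a)` for `a ≠ 0` in `ℤ_p`. The value at `a = 0`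
is a convention and is never used: it is always multiplied by `χ(0) = 0`. -/
def angle (a : ℤ_[p]) : ℚ_[p] :=
  if h : a = 0 then 1
  else ((PadicInt.unitCoeff h : ℤ_[p]) : ℚ_[p]) /
    (teichmullerLift p (PadicInt.toZMod (PadicInt.unitCoeff h : ℤ_[p])) : ℚ_[p])

/-- The terms of the binomial series `∑ binom(s, n) (⟨a⟩ - 1) ^ n`. -/
def anglePowTerm (a : ℤ_[p]) (s : ℂ_[p]) (n : ℕ) : ℂ_[p] :=
  Ring.choose s n * (algebraMap ℚ_[p] ℂ_[p] (angle a) - 1) ^ n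

/-- `⟨a⟩ ^ s` for `s ∈ ℂ_p`. -/
def anglePow (a : ℤ_[p]) (s : ℂ_[p]) : ℂ_[p] := ∑' n : ℕ, anglePowTerm a s n

/-! ### Volkenborn integral and Cohen's `p`-adic Hurwitz zeta function -/

/-- The sums `p ^ (-N) ∑_{0 ≤ a < p ^ N} f(a)`, whose limit is the Volkenborn integral. -/
def volkenbornSum (f : ℤ_[p] → ℂ_[p]) (N : ℕ) : ℂ_[p] :=
  ((p : ℂ_[p]) ^ N)⁻¹ * ∑ a ∈ Finset.range (p ^ N), f (a : ℤ_[p])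

/-- The Volkenborn integral `∫_{ℤ_p} f(a) da`. -/
def volkenbornIntegral (f : ℤ_[p] → ℂ_[p]) : ℂ_[p] := limUnder atTop (volkenbornSum f)

/-- A function on `ℂ_p \ {1}`, given a value at `1` by continuity. -/
def extendAtOne (f : ℂ_[p] → ℂ_[p]) : ℂ_[p] → ℂ_[p] :=
  letI := Classical.decEq ℂ_[p]
  Function.update f 1 (limUnder (𝓝[≠] 1) f)

theorem extendAtOne_of_ne (f : ℂ_[p] → ℂ_[p]) {z : ℂ_[p]} (h : z ≠ 1) :
    extendAtOne f z = f z := by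
  classical
  exact Function.update_of_ne h _ _

/-- The integrand `a ↦ χ(x + a) ⟨x + a⟩ ^ (1 - s)`. -/
def hurwitzIntegrand {v : ℕ} (s : ℂ_[p]) (χ : DirichletCharacter ℂ_[p] (p ^ (v + 1)))
    (x a : ℤ_[p]) : ℂ_[p] :=
  extendChar χ (x + a) * anglePow (x + a) (1 - s)

/-- The `p`-adic Hurwitz zeta function
`ζ_p(s, χ, x) = (s - 1)⁻¹ ∫_{ℤ_p} χ(x + a) ⟨x + a⟩ ^ (1 - s) da`
(for `s = 1`: the limit, when there is one). -/
def hurwitzZeta {v : ℕ} (s : ℂ_[p]) (χ : DirichletCharacter ℂ_[p] (p ^ (v + 1)))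
    (x : ℤ_[p]) : ℂ_[p] :=
  extendAtOne (fun z ↦ (z - 1)⁻¹ * volkenbornIntegral (hurwitzIntegrand z χ x)) s

/-- The extended constant term `a_0(s, χ, x) = ½ ζ_p(1 - s, χ, x)`. -/
def constantTerm {v : ℕ} (s : ℂ_[p]) (χ : DirichletCharacter ℂ_[p] (p ^ (v + 1)))
    (x : ℤ_[p]) : ℂ_[p] :=
  1 / 2 * hurwitzZeta (1 - s) χ x

/-! ### Iwasawa's `p`-adic `L`-function, by `p`-adic interpolation -/

/-- The generalized Bernoulli number
`B_{n, χ} = f ^ (n - 1) ∑_{a = 1}^{f} χ(a) B_n(a / f)` for a character `χ` modulo `f`. -/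
def generalizedBernoulli {f : ℕ} (χ : DirichletCharacter ℂ_[p] f) (n : ℕ) : ℂ_[p] :=
  (f : ℂ_[p]) ^ ((n : ℤ) - 1) *
    ∑ a ∈ Finset.Icc 1 f,
      χ (a : ZMod f) * Polynomial.aeval ((a : ℂ_[p]) / (f : ℂ_[p])) (Polynomial.bernoulli n)

/-- `b_n = (1 - χ_n(p) p ^ (n - 1)) B_{n, χ_n}`, where `χ_n` is the primitive character
attached to `χ ω ^ (-n)`. -/
def interpolationValue {v : ℕ} (χ : DirichletCharacter ℂ_[p] (p ^ (v + 1))) (n : ℕ) : ℂ_[p] :=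
  let ψ := (χ * (omega p v ^ n)⁻¹).primitiveCharacter
  (1 - ψ (p : ZMod _) * (p : ℂ_[p]) ^ ((n : ℤ) - 1)) * generalizedBernoulli ψ n

/-- The terms `c_n binom(t, n)`, `c_n = ∑_i (-1) ^ (n - i) binom(n, i) b_i`, of the series
interpolating the numbers `b_n`. -/
def interpolationTerm {v : ℕ} (χ : DirichletCharacter ℂ_[p] (p ^ (v + 1))) (t : ℂ_[p]) (n : ℕ) :
    ℂ_[p] :=
  (fwdDiff 1)^[n] (interpolationValue χ) 0 * Ring.choose t n

/-- The `p`-adic `L`-function `L_p(s, χ) = (s - 1)⁻¹ A_χ(1 - s)`, where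
`A_χ(t) = ∑ c_n binom(t, n)` is the function with `A_χ(n) = b_n` for all `n ≥ 0`
(for `s = 1`: the limit, when there is one). -/
def padicL {v : ℕ} (s : ℂ_[p]) (χ : DirichletCharacter ℂ_[p] (p ^ (v + 1))) : ℂ_[p] :=
  extendAtOne (fun z ↦ (z - 1)⁻¹ * ∑' n : ℕ, interpolationTerm χ (1 - z) n) s

theorem tsum_interpolationTerm_natCast {v : ℕ} (χ : DirichletCharacter ℂ_[p] (p ^ (v + 1)))
    (n : ℕ) : ∑' k : ℕ, interpolationTerm χ (n : ℂ_[p]) k = interpolationValue χ n := by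
  rw [tsum_eq_sum (s := Finset.range (n + 1))]
  · have h := shift_eq_sum_fwdDiff_iter (1 : ℕ) (interpolationValue χ) n 0
    simp only [smul_eq_mul, mul_one, zero_add] at h
    rw [h]
    refine Finset.sum_congr rfl fun k _ ↦ ?_
    rw [interpolationTerm, Ring.choose_natCast, nsmul_eq_mul, mul_comm]
  · intro k hk
    rw [interpolationTerm, Ring.choose_natCast,
      Nat.choose_eq_zero_of_lt (by simpa [Nat.lt_succ_iff] using hk)]
    simp

/-- The interpolation property `L_p(1 - n, χ) = -(1 - χ_n(p) p ^ (n - 1)) B_{n, χ_n} / n`. -/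
theorem padicL_one_sub_natCast {v : ℕ} (χ : DirichletCharacter ℂ_[p] (p ^ (v + 1)))
    (n : ℕ) (hn : n ≠ 0) :
    padicL (1 - (n : ℂ_[p])) χ = -(interpolationValue χ n / n) := by
  have h : (1 - (n : ℂ_[p])) ≠ 1 := by simpa [sub_eq_self] using hn
  rw [padicL, extendAtOne_of_ne _ h, sub_sub_cancel,
    tsum_interpolationTerm_natCast, sub_sub_cancel_left, inv_neg, neg_mul, div_eq_inv_mul]

/-! ### The `p`-adic Eisenstein series -/

/-- The `q`-expansion `G_k = -B_k / (2 k) + ∑_{n ≥ 1} σ_{k-1}(n) q ^ n`. -/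
def eisensteinQExp (k : ℕ) : PowerSeries ℚ :=
  PowerSeries.mk fun n ↦
    if n = 0 then -bernoulli k / (2 * k) else (ArithmeticFunction.sigma (k - 1) n : ℚ)

/-- Even weights `k → ∞` converging to `(s, u)` in `X = ℤ_p × ℤ/(p-1)ℤ`. -/
def weightFilter (s : ℤ_[p]) (u : ZMod (p - 1)) : Filter ℕ :=
  atTop ⊓ comap (fun k : ℕ ↦ (k : ℤ_[p])) (𝓝 s) ⊓ 𝓟 {k : ℕ | Even k ∧ (k : ZMod (p - 1)) = u}

/-- The `p`-adic Eisenstein series `G*_{s,u}`, the limit of the `q`-expansions `G_k` over even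
`k → ∞` with `k → (s, u)` in `X`. -/
def padicEisenstein (s : ℤ_[p]) (u : ZMod (p - 1)) : PowerSeries ℚ_[p] :=
  PowerSeries.mk fun n ↦
    limUnder (weightFilter s u) fun k ↦ ((PowerSeries.coeff n (eisensteinQExp k) : ℚ) : ℚ_[p])

end PadicEisenstein

end

/-! Write `e` for an exponent representing `u`. Cohen's zeta function and Iwasawa's `L`-function are
both `(z - 1)⁻¹ A(1 - z)` for the same `A(t) = ∑ c_n binom(t, n)`, and the constant terms of the
`G_k` are, up to a factor tending to 1, the values `-A(k) / (2k)`.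

On `p`-adic units `ω^e(a) ⟨a⟩^m = ω^(e-m)(a) a^m`, and the Volkenborn sums of the right side,
extended by zero, tend to `b_m` (`tendsto_volkenbornSum_pow`). Taking differences in `m`, the
integral of `ω^e(a) (⟨a⟩ - 1)^n` is `c_n`. Its Volkenborn sums have norm at most `p^(2-n)`,
uniformly in `N`, since `⟨a⟩ - 1` is divisible by `p` with a nearly Lipschitz quotient; and
`|binom(t, n)| ≤ p^(n/2)` for `|t| ≤ 1` and `p` odd. Dominated convergence therefore exchanges the
integral with the binomial series (`tendsto_volkenbornSum_hurwitzIntegrand`), and the same bounds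
make `A` continuous on the unit ball.

For `k > 1` with `k ≡ u` modulo `p - 1`, `A(k) = (1 - p^(k-1)) B_k`. Continuity of `A` then settles
`s ≠ 0`. If `s = 0`, then `ω^u` is nontrivial, so `A(0) = b_0 = 0` and `A(t) / t` extends
continuously to 0 (`interpolantSlope`). -/

noncomputable section

namespace PadicEisenstein

/-! ### Norms on `ℂ_p` and the embedding of `ℤ_p` -/

variable {p : ℕ} [hp : Fact p.Prime]

/-- The embedding of `ℤ_p` into `ℂ_p`. -/
def intEmb : ℤ_[p] →+* ℂ_[p] := (algebraMap ℚ_[p] ℂ_[p]).comp PadicInt.Coe.ringHom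

theorem intEmb_apply (x : ℤ_[p]) : intEmb x = algebraMap ℚ_[p] ℂ_[p] (x : ℚ_[p]) := rfl

theorem norm_intEmb (x : ℤ_[p]) : ‖(intEmb x : ℂ_[p])‖ = ‖x‖ := by
  rw [intEmb_apply, norm_algebraMap', PadicInt.norm_def]

theorem norm_natCast_padicComplex (n : ℕ) : ‖(n : ℂ_[p])‖ = ‖(n : ℚ_[p])‖ := by
  rw [← map_natCast (algebraMap ℚ_[p] ℂ_[p]), norm_algebraMap']

theorem norm_natCast_le_one (n : ℕ) : ‖(n : ℂ_[p])‖ ≤ 1 := by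
  rw [← map_natCast intEmb, norm_intEmb]
  exact PadicInt.norm_le_one _

theorem natCast_prime_ne_zero : (p : ℂ_[p]) ≠ 0 := Nat.cast_ne_zero.mpr hp.out.ne_zero

theorem norm_prime : ‖(p : ℂ_[p])‖ = (p : ℝ)⁻¹ := by
  rw [norm_natCast_padicComplex, Padic.norm_p]

theorem tendsto_prime_pow : Tendsto (fun N : ℕ ↦ (p : ℂ_[p]) ^ N) atTop (𝓝 0) := by
  apply tendsto_pow_atTop_nhds_zero_of_norm_lt_one
  rw [norm_prime]
  exact inv_lt_one_of_one_lt₀ (by exact_mod_cast hp.out.one_lt)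

/-! ### Sums over initial segments -/

theorem sum_range_mul_eq {M : Type*} [AddCommMonoid M] (m n : ℕ) (f : ℕ → M) :
    ∑ a ∈ Finset.range (m * n), f a =
      ∑ r ∈ Finset.range m, ∑ b ∈ Finset.range n, f (r + m * b) := by
  rw [Finset.sum_comm, mul_comm]
  induction n with
  | zero => simp
  | succ n ih =>
    rw [add_mul, one_mul, Finset.sum_range_add, ih, Finset.sum_range_succ]
    congr 1
    exact Finset.sum_congr rfl fun r _ ↦ by rw [add_comm, mul_comm]

/-- Cut the first `p^(N+1)` integers into `p` translates of the first `p^N`: the sum at level `N +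
1` differs from `p` times the sum at level `N` by terms `g(a + p^N c) - g(a)`, divisible by
`p^(N-1)`. The factor `p^2` makes up for the two missing powers, and induction applies. -/
theorem pow_dvd_mul_sum_of_lipschitz (g : ℕ → ℤ_[p])
    (hg : ∀ N a c : ℕ, (p : ℤ_[p]) ^ N ∣ g (a + p ^ (N + 1) * c) - g a) (N : ℕ) :
    (p : ℤ_[p]) ^ N ∣ (p : ℤ_[p]) ^ 2 * ∑ a ∈ Finset.range (p ^ N), g a := by
  induction N with
  | zero => simp
  | succ N ih =>
    have key : (p : ℤ_[p]) ^ (N + 1) ∣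
        (p : ℤ_[p]) ^ 2 * (∑ a ∈ Finset.range (p ^ (N + 1)), g a -
          p * ∑ a ∈ Finset.range (p ^ N), g a) := by
      rw [pow_succ p N, sum_range_mul_eq, Finset.mul_sum, ← Finset.sum_sub_distrib, Finset.mul_sum]
      refine Finset.dvd_sum fun a _ ↦ ?_
      have : (p : ℤ_[p]) * g a = ∑ _c ∈ Finset.range p, g a := by simp
      rw [this, ← Finset.sum_sub_distrib, Finset.mul_sum]
      refine Finset.dvd_sum fun c _ ↦ ?_
      -- At level 0 the hypothesis on `g` gives nothing, but `p ∣ p^2` suffices.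
      cases N with
      | zero => exact Dvd.dvd.mul_right (pow_dvd_pow _ (by norm_num)) _
      | succ N =>
        rw [show N + 1 + 1 = 2 + N by ring, pow_add]
        exact mul_dvd_mul_left _ (hg N a c)
    rw [mul_sub] at key
    have h2 : (p : ℤ_[p]) ^ (N + 1) ∣
        (p : ℤ_[p]) ^ 2 * (p * ∑ a ∈ Finset.range (p ^ N), g a) := by
      rw [pow_succ', mul_left_comm]
      exact mul_dvd_mul_left _ ih
    exact (dvd_iff_dvd_of_dvd_sub key).mpr h2

theorem norm_volkenbornSum_le_of_lipschitz (g : ℤ_[p] → ℤ_[p])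
    (hg : ∀ (N : ℕ) (a b : ℤ_[p]), (p : ℤ_[p]) ^ (N + 1) ∣ a - b → (p : ℤ_[p]) ^ N ∣ g a - g b)
    (N : ℕ) : ‖volkenbornSum (fun a ↦ (intEmb (g a) : ℂ_[p])) N‖ ≤ (p : ℝ) ^ 2 := by
  obtain ⟨y, hy⟩ := pow_dvd_mul_sum_of_lipschitz (fun a ↦ g a)
    (fun N a c ↦ hg N _ _ ⟨c, by push_cast; ring⟩) N
  have hp0 : (p : ℂ_[p]) ≠ 0 := natCast_prime_ne_zero
  have h : volkenbornSum (fun a ↦ (intEmb (g a) : ℂ_[p])) N = ((p : ℂ_[p]) ^ 2)⁻¹ * intEmb y := by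
    have := congrArg (intEmb (p := p)) hy
    simp only [map_mul, map_pow, map_natCast, map_sum] at this
    rw [volkenbornSum, eq_inv_mul_iff_mul_eq₀ (pow_ne_zero _ hp0), mul_left_comm, this,
      inv_mul_cancel_left₀ (pow_ne_zero _ hp0)]
  rw [h, norm_mul, norm_inv, norm_pow, norm_prime, norm_intEmb, inv_pow, inv_inv]
  exact mul_le_of_le_one_right (by positivity) (PadicInt.norm_le_one _)

/-! ### Binomial coefficients on the closed unit ball of `ℂ_p` -/

/-- Legendre's formula gives `v_p(n!) ≤ n / (p - 1)`, which is at most `n / 2` because `p ≥ 3`. -/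
theorem inv_pow_le_norm_factorial_sq (hp2 : p ≠ 2) (n : ℕ) :
    ((p : ℝ)⁻¹) ^ n ≤ ‖(n.factorial : ℂ_[p])‖ ^ 2 := by
  have h3 : 3 ≤ p := by
    have := hp.out.two_le
    omega
  rw [norm_natCast_padicComplex, Padic.norm_eq_zpow_neg_valuation (by simp [Nat.factorial_ne_zero]),
    Padic.valuation_natCast, zpow_neg, zpow_natCast, ← inv_pow, ← pow_mul]
  refine pow_le_pow_of_le_one (by positivity)
    (inv_le_one_of_one_le₀ (by exact_mod_cast hp.out.one_le)) ?_
  have h := sub_one_mul_padicValNat_factorial (p := p) n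
  calc _ ≤ (p - 1) * padicValNat p n.factorial := by
        rw [mul_comm]; exact Nat.mul_le_mul_right _ (by omega)
    _ ≤ n := by omega

theorem choose_succ_right (t : ℂ_[p]) (n : ℕ) :
    Ring.choose t (n + 1) = t * (Ring.choose (t - 1) n / (n + 1)) := by
  have h := Ring.choose_smul_choose t (Nat.le_add_left 1 n)
  rw [Nat.choose_one_right, nsmul_eq_mul, Ring.choose_one_right, Nat.cast_one,
    Nat.add_sub_cancel] at h
  have h0 : ((n : ℂ_[p]) + 1) ≠ 0 := by exact_mod_cast Nat.succ_ne_zero n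
  field_simp
  rw [← h]
  push_cast
  ring

theorem norm_sub_one_le {t : ℂ_[p]} (ht : ‖t‖ ≤ 1) : ‖t - 1‖ ≤ 1 := by
  rw [sub_eq_add_neg]
  refine (IsUltrametricDist.norm_add_le_max t (-1)).trans ?_
  simp [ht]

/-- The product is `t (t - 1) ⋯ (t - n + 1)`, whose factors all lie in the unit ball. -/
theorem norm_factorial_mul_choose_le (t : ℂ_[p]) (ht : ‖t‖ ≤ 1) (n : ℕ) :
    ‖(n.factorial : ℂ_[p]) * Ring.choose t n‖ ≤ 1 := by
  induction n generalizing t with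
  | zero => simp
  | succ n ih =>
    have h0 : ((n : ℂ_[p]) + 1) ≠ 0 := by exact_mod_cast Nat.succ_ne_zero n
    have : ((n + 1).factorial : ℂ_[p]) * Ring.choose t (n + 1) =
        t * (n.factorial * Ring.choose (t - 1) n) := by
      rw [choose_succ_right, Nat.factorial_succ]
      push_cast
      field_simp
    rw [this, norm_mul]
    refine mul_le_one₀ ht (norm_nonneg _) (ih _ ?_)
    exact norm_sub_one_le ht

theorem continuous_choose (n : ℕ) : Continuous fun t : ℂ_[p] ↦ Ring.choose t n := by
  induction n with
  | zero => simp [continuous_const]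
  | succ n ih =>
    simp only [choose_succ_right]
    exact continuous_id.mul ((ih.comp (continuous_id.sub continuous_const)).div_const _)

/-- The common ratio `p ^ (-1/2)` of the geometric series used as majorants. -/
def ratio (p : ℕ) : ℝ := √((p : ℝ)⁻¹)

theorem ratio_pos : 0 < ratio p :=
  Real.sqrt_pos.mpr (inv_pos.mpr (by exact_mod_cast hp.out.pos))

theorem ratio_sq (p : ℕ) : ratio p ^ 2 = (p : ℝ)⁻¹ := Real.sq_sqrt (by positivity)

theorem ratio_lt_one : ratio p < 1 := by
  rw [ratio, Real.sqrt_lt' one_pos, one_pow]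
  exact inv_lt_one_of_one_lt₀ (by exact_mod_cast hp.out.one_lt)

theorem ratio_pow_le_norm_factorial (hp2 : p ≠ 2) (n : ℕ) :
    ratio p ^ n ≤ ‖(n.factorial : ℂ_[p])‖ := by
  refine le_of_sq_le_sq ?_ (norm_nonneg _)
  rw [← pow_mul, mul_comm, pow_mul, ratio_sq]
  exact inv_pow_le_norm_factorial_sq hp2 n

/-- Split `p^(-n)` into two factors `p^(-n/2)`: one is absorbed by `|n!|`, the other remains as a
summable majorant. -/
theorem mul_norm_le_of_norm_factorial_mul_le (hp2 : p ≠ 2) {n : ℕ} {x : ℂ_[p]}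
    (h : ‖(n.factorial : ℂ_[p]) * x‖ ≤ 1) : ((p : ℝ)⁻¹) ^ n * ‖x‖ ≤ ratio p ^ n := by
  have hr := ratio_pos (p := p)
  rw [norm_mul] at h
  rw [← ratio_sq, ← pow_mul, mul_comm 2 n, pow_mul, sq, mul_assoc]
  refine mul_le_of_le_one_right (by positivity) (le_trans ?_ h)
  exact mul_le_mul_of_nonneg_right (ratio_pow_le_norm_factorial hp2 n) (norm_nonneg _)

theorem norm_choose_le (hp2 : p ≠ 2) {t : ℂ_[p]} (ht : ‖t‖ ≤ 1) (n : ℕ) :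
    ((p : ℝ)⁻¹) ^ n * ‖Ring.choose t n‖ ≤ ratio p ^ n :=
  mul_norm_le_of_norm_factorial_mul_le hp2 (norm_factorial_mul_choose_le t ht n)

/-- The division by `n + 1` costs nothing, because `(n + 1)! / (n + 1) = n!`. -/
theorem norm_choose_sub_one_div_le (hp2 : p ≠ 2) {t : ℂ_[p]} (ht : ‖t‖ ≤ 1) (n : ℕ) :
    ((p : ℝ)⁻¹) ^ (n + 1) * ‖Ring.choose (t - 1) n / (n + 1)‖ ≤ ratio p ^ (n + 1) := by
  apply mul_norm_le_of_norm_factorial_mul_le hp2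
  have h0 : ((n : ℂ_[p]) + 1) ≠ 0 := by exact_mod_cast Nat.succ_ne_zero n
  have : ((n + 1).factorial : ℂ_[p]) * (Ring.choose (t - 1) n / (n + 1)) =
      n.factorial * Ring.choose (t - 1) n := by
    rw [Nat.factorial_succ]
    push_cast
    field_simp
  rw [this]
  refine norm_factorial_mul_choose_le _ (norm_sub_one_le ht) n

theorem summable_ratio_pow : Summable fun n : ℕ ↦ ratio p ^ n :=
  summable_geometric_of_lt_one ratio_pos.le ratio_lt_one

/-! ### Bernoulli polynomials and power sums -/

theorem sum_add_pow_eq_bernoulli_sub (x : ℚ) (m M : ℕ) :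
    ((m : ℚ) + 1) * ∑ b ∈ Finset.range M, (x + b) ^ m =
      (Polynomial.bernoulli (m + 1)).eval (x + M) - (Polynomial.bernoulli (m + 1)).eval x := by
  induction M with
  | zero => simp
  | succ M ih =>
    rw [Finset.sum_range_succ, mul_add, ih, Nat.cast_succ,
      show x + ((M : ℚ) + 1) = 1 + (x + M) by ring, Polynomial.bernoulli_eval_one_add]
    push_cast
    ring

theorem aeval_ratCast (P : Polynomial ℚ) (x : ℚ) :
    Polynomial.aeval (x : ℂ_[p]) P = ((P.eval x : ℚ) : ℂ_[p]) := by
  have := Polynomial.aeval_algebraMap_apply_eq_algebraMap_eval (A := ℂ_[p]) x P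
  simpa using this

/-- The expression is the difference quotient of `B_{m+1} / (m + 1)` at `x` with step `p^N`, which
tends to 0 in `ℂ_p`; the limit is the derivative `B_m(x)`. -/
theorem tendsto_inv_mul_sum_add_pow (x : ℚ) (m : ℕ) :
    Tendsto (fun N : ℕ ↦ ((p : ℂ_[p]) ^ N)⁻¹ * ∑ b ∈ Finset.range (p ^ N), ((x : ℂ_[p]) + b) ^ m)
      atTop (𝓝 (Polynomial.aeval (x : ℂ_[p]) (Polynomial.bernoulli m))) := by
  have hp0 : (p : ℂ_[p]) ≠ 0 := natCast_prime_ne_zero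
  have hm : ((m : ℂ_[p]) + 1) ≠ 0 := by exact_mod_cast Nat.succ_ne_zero m
  have hd := (Polynomial.bernoulli (m + 1)).hasDerivAt_aeval (x : ℂ_[p])
  rw [hasDerivAt_iff_tendsto_slope_zero] at hd
  have hlim : Tendsto (fun N : ℕ ↦ (p : ℂ_[p]) ^ N) atTop (𝓝[≠] 0) :=
    tendsto_nhdsWithin_iff.mpr ⟨tendsto_prime_pow, .of_forall fun N ↦ pow_ne_zero _ hp0⟩
  have h := (hd.comp hlim).const_mul ((m : ℂ_[p]) + 1)⁻¹
  rw [Polynomial.derivative_bernoulli_add_one] at h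
  simp only [map_mul, map_add, map_natCast, map_one, inv_mul_cancel_left₀ hm] at h
  refine h.congr fun N ↦ ?_
  have e := congrArg (fun y : ℚ ↦ (y : ℂ_[p])) (sum_add_pow_eq_bernoulli_sub x m (p ^ N))
  push_cast at e
  rw [← aeval_ratCast, ← aeval_ratCast] at e
  push_cast at e
  rw [Function.comp_apply, ← e, smul_eq_mul, mul_left_comm, inv_mul_cancel_left₀ hm]

/-! ### Generalized Bernoulli numbers as limits of power sums -/

theorem zpow_natCast_sub_one (m : ℕ) :
    (p : ℂ_[p]) ^ ((m : ℤ) - 1) = (p : ℂ_[p])⁻¹ * (p : ℂ_[p]) ^ m := by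
  rw [zpow_sub₀ natCast_prime_ne_zero, zpow_natCast, zpow_one, div_eq_inv_mul]

theorem generalizedBernoulli_prime_level (ψ : DirichletCharacter ℂ_[p] p) (m : ℕ) :
    generalizedBernoulli ψ m = (p : ℂ_[p])⁻¹ * ∑ r ∈ Finset.range p, ψ r * ((p : ℂ_[p]) ^ m *
      Polynomial.aeval (((r : ℚ) / p : ℚ) : ℂ_[p]) (Polynomial.bernoulli m)) := by
  have hz : ψ (0 : ZMod p) = 0 := MulChar.map_nonunit ψ (by simp)
  have h : ∀ f : ℕ → ℂ_[p], f 0 = 0 → f p = 0 →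
      ∑ r ∈ Finset.Icc 1 p, f r = ∑ r ∈ Finset.range p, f r := by
    intro f h0 h1
    have e := (Finset.sum_range_succ f p).symm.trans (Finset.sum_range_succ' f p)
    rw [h0, h1, add_zero, add_zero] at e
    rw [e, show Finset.Icc 1 p = Finset.Ico 1 (p + 1) from rfl, Finset.sum_Ico_eq_sum_range]
    exact Finset.sum_congr rfl fun i _ ↦ by rw [add_comm]
  rw [generalizedBernoulli, h _ (by simp [hz]) (by simp [hz]), zpow_natCast_sub_one, mul_assoc,
    Finset.mul_sum]
  congr 1
  refine Finset.sum_congr rfl fun r _ ↦ ?_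
  push_cast
  ring

theorem sum_prime_pow_succ (ψ : DirichletCharacter ℂ_[p] p) (m N : ℕ) :
    ((p : ℂ_[p]) ^ (N + 1))⁻¹ * ∑ a ∈ Finset.range (p ^ (N + 1)), ψ a * (a : ℂ_[p]) ^ m =
      (p : ℂ_[p])⁻¹ * ∑ r ∈ Finset.range p, ψ r * ((p : ℂ_[p]) ^ m *
        (((p : ℂ_[p]) ^ N)⁻¹ * ∑ b ∈ Finset.range (p ^ N),
          ((((r : ℚ) / p : ℚ) : ℂ_[p]) + b) ^ m)) := by
  have hp0 : (p : ℂ_[p]) ≠ 0 := natCast_prime_ne_zero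
  rw [pow_succ' p, sum_range_mul_eq, pow_succ', mul_inv, mul_assoc, Finset.mul_sum]
  congr 1
  refine Finset.sum_congr rfl fun r _ ↦ ?_
  rw [Finset.mul_sum, Finset.mul_sum, Finset.mul_sum, Finset.mul_sum]
  refine Finset.sum_congr rfl fun b _ ↦ ?_
  have h1 : ((r + p * b : ℕ) : ZMod p) = r := by simp
  have h2 : ((r + p * b : ℕ) : ℂ_[p]) = p * ((((r : ℚ) / p : ℚ) : ℂ_[p]) + b) := by
    push_cast
    field_simp
  rw [h1, h2, mul_pow]
  ring

theorem tendsto_generalizedBernoulli (ψ : DirichletCharacter ℂ_[p] p) (m : ℕ) :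
    Tendsto (fun N : ℕ ↦ ((p : ℂ_[p]) ^ N)⁻¹ *
      ∑ a ∈ Finset.range (p ^ N), ψ a * (a : ℂ_[p]) ^ m) atTop
      (𝓝 (generalizedBernoulli ψ m)) := by
  rw [← tendsto_add_atTop_iff_nat 1]
  simp only [sum_prime_pow_succ]
  rw [generalizedBernoulli_prime_level]
  exact (tendsto_finsetSum _ fun r _ ↦
    ((tendsto_inv_mul_sum_add_pow _ m).const_mul _).const_mul _).const_mul _

/-- The trivial character removes the multiples of `p`. Since it kills both 0 and `p M`, the range
may be shifted to `1, …, p M`; the bases `1 + b` then lead to `B_m(1)`, the value occurring in the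
generalized Bernoulli number of conductor one. -/
theorem sum_trivialChar_mul_pow (m M : ℕ) :
    ∑ a ∈ Finset.range (p * M), (1 : DirichletCharacter ℂ_[p] p) a * (a : ℂ_[p]) ^ m =
      ∑ b ∈ Finset.range (p * M), (1 + (b : ℂ_[p])) ^ m -
        (p : ℂ_[p]) ^ m * ∑ b ∈ Finset.range M, (1 + (b : ℂ_[p])) ^ m := by
  induction M with
  | zero => simp
  | succ M ih =>
    obtain ⟨q, hq⟩ := Nat.exists_eq_succ_of_ne_zero hp.out.ne_zero
    have h1 : ∑ r ∈ Finset.range p, (1 : DirichletCharacter ℂ_[p] p) ((p * M + r : ℕ) : ZMod p) *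
        ((p * M + r : ℕ) : ℂ_[p]) ^ m =
        ∑ r ∈ Finset.range q, (1 + ((p * M + r : ℕ) : ℂ_[p])) ^ m := by
      have hz : (1 : DirichletCharacter ℂ_[p] p) ((p * M + 0 : ℕ) : ZMod p) = 0 :=
        MulChar.map_nonunit _ (by simp)
      have hr : Finset.range p = Finset.range (q + 1) := by rw [hq]
      rw [hr, Finset.sum_range_succ', hz, zero_mul, add_zero]
      refine Finset.sum_congr rfl fun r hr ↦ ?_
      have hu : IsUnit ((p * M + (r + 1) : ℕ) : ZMod p) := by
        rw [isUnit_iff_ne_zero, Nat.cast_add, Nat.cast_mul, ZMod.natCast_self, zero_mul, zero_add,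
          Ne, ZMod.natCast_eq_zero_iff]
        refine Nat.not_dvd_of_pos_of_lt (Nat.succ_pos r) ?_
        have := Finset.mem_range.mp hr
        omega
      rw [MulChar.one_apply hu, one_mul]
      push_cast
      ring
    have h2 : ∑ r ∈ Finset.range p, (1 + ((p * M + r : ℕ) : ℂ_[p])) ^ m =
        ∑ r ∈ Finset.range q, (1 + ((p * M + r : ℕ) : ℂ_[p])) ^ m +
          (p : ℂ_[p]) ^ m * (1 + (M : ℂ_[p])) ^ m := by
      have hr : Finset.range p = Finset.range (q + 1) := by rw [hq]
      have hqc : (p : ℂ_[p]) = q + 1 := by exact_mod_cast congrArg (Nat.cast (R := ℂ_[p])) hq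
      rw [hr, Finset.sum_range_succ, ← mul_pow]
      congr 2
      push_cast
      rw [hqc]
      ring
    rw [mul_add, mul_one, Finset.sum_range_add, Finset.sum_range_add, ih, h1, h2,
      Finset.sum_range_succ]
    ring

theorem tendsto_trivialChar (m : ℕ) :
    Tendsto (fun N : ℕ ↦ ((p : ℂ_[p]) ^ N)⁻¹ *
      ∑ a ∈ Finset.range (p ^ N), (1 : DirichletCharacter ℂ_[p] p) a * (a : ℂ_[p]) ^ m) atTop
      (𝓝 ((1 - (p : ℂ_[p]) ^ ((m : ℤ) - 1)) *
        Polynomial.aeval (1 : ℂ_[p]) (Polynomial.bernoulli m))) := by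
  have hp0 : (p : ℂ_[p]) ≠ 0 := natCast_prime_ne_zero
  have h1 : Tendsto (fun N : ℕ ↦ ((p : ℂ_[p]) ^ N)⁻¹ * ∑ b ∈ Finset.range (p ^ N),
      (((1 : ℚ) : ℂ_[p]) + b) ^ m) atTop
      (𝓝 (Polynomial.aeval ((1 : ℚ) : ℂ_[p]) (Polynomial.bernoulli m))) :=
    tendsto_inv_mul_sum_add_pow 1 m
  rw [Rat.cast_one] at h1
  rw [← tendsto_add_atTop_iff_nat 1, sub_mul, one_mul]
  refine (((tendsto_add_atTop_iff_nat 1).mpr h1).sub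
    (h1.const_mul ((p : ℂ_[p]) ^ ((m : ℤ) - 1)))).congr fun N ↦ ?_
  rw [pow_succ' p, sum_trivialChar_mul_pow, zpow_natCast_sub_one, pow_succ', mul_inv]
  ring

/-- A conductor equals the level only propositionally, so values are transported along `d = n`. -/
theorem apply_eq_of_changeLevel_eq {d n : ℕ} (h : d ∣ n) (hdn : d = n)
    (ψ : DirichletCharacter ℂ_[p] d) (m a : ℕ) :
    DirichletCharacter.changeLevel h ψ a = ψ a ∧
    generalizedBernoulli (DirichletCharacter.changeLevel h ψ) m = generalizedBernoulli ψ m := by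
  subst hdn
  rw [DirichletCharacter.changeLevel_self]
  exact ⟨rfl, rfl⟩

/-- The Euler factor times the generalized Bernoulli number of a primitive character. -/
def eulerBernoulli {f : ℕ} (ψ : DirichletCharacter ℂ_[p] f) (m : ℕ) : ℂ_[p] :=
  (1 - ψ (p : ZMod f) * (p : ℂ_[p]) ^ ((m : ℤ) - 1)) * generalizedBernoulli ψ m

theorem interpolationValue_eq {v : ℕ} (χ : DirichletCharacter ℂ_[p] (p ^ (v + 1))) (n : ℕ) :
    interpolationValue χ n =
      eulerBernoulli (χ * (omega p v ^ n)⁻¹).primitiveCharacter n := rfl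

/-- A nontrivial character of prime level is primitive and vanishes at `p`, so its Euler factor is
1. -/
theorem eulerBernoulli_primitiveCharacter_of_ne_one {ψ : DirichletCharacter ℂ_[p] p} (hψ : ψ ≠ 1)
    (m : ℕ) : eulerBernoulli ψ.primitiveCharacter m = generalizedBernoulli ψ m := by
  have hc : ψ.conductor = p := by
    refine ((Nat.dvd_prime hp.out).mp ψ.conductor_dvd_level).resolve_left fun h ↦ hψ ?_
    exact ψ.eq_one_iff_conductor_eq_one.mpr h
  obtain ⟨h1, h2⟩ :=
    apply_eq_of_changeLevel_eq ψ.conductor_dvd_level hc ψ.primitiveCharacter m p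
  rw [ψ.changeLevel_primitiveCharacter] at h1 h2
  have hz : ψ ((p : ℕ) : ZMod p) = 0 := MulChar.map_nonunit ψ (by simp)
  rw [eulerBernoulli, ← h1, ← h2, hz]
  simp

theorem eulerBernoulli_level_one {f : ℕ} (hf : f = 1) (ψ : DirichletCharacter ℂ_[p] f) (m : ℕ) :
    eulerBernoulli ψ m = (1 - (p : ℂ_[p]) ^ ((m : ℤ) - 1)) *
      Polynomial.aeval (1 : ℂ_[p]) (Polynomial.bernoulli m) := by
  subst hf
  have h (a : ZMod 1) : ψ a = 1 := by
    rw [Subsingleton.elim a 1, map_one]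
  simp [eulerBernoulli, generalizedBernoulli, h]

theorem eulerBernoulli_primitiveCharacter_one (m : ℕ) :
    eulerBernoulli (1 : DirichletCharacter ℂ_[p] p).primitiveCharacter m =
      (1 - (p : ℂ_[p]) ^ ((m : ℤ) - 1)) *
        Polynomial.aeval (1 : ℂ_[p]) (Polynomial.bernoulli m) :=
  eulerBernoulli_level_one DirichletCharacter.conductor_one _ m

theorem tendsto_eulerBernoulli {f : ℕ} (hf : f = p) (ψ : DirichletCharacter ℂ_[p] f) (m : ℕ) :
    Tendsto (fun N : ℕ ↦ ((p : ℂ_[p]) ^ N)⁻¹ *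
      ∑ a ∈ Finset.range (p ^ N), ψ a * (a : ℂ_[p]) ^ m) atTop
      (𝓝 (eulerBernoulli ψ.primitiveCharacter m)) := by
  subst hf
  by_cases hψ : ψ = 1
  · rw [hψ, eulerBernoulli_primitiveCharacter_one]
    exact tendsto_trivialChar m
  · rw [eulerBernoulli_primitiveCharacter_of_ne_one hψ]
    exact tendsto_generalizedBernoulli ψ m

/-! ### The Teichmüller character and the projection to principal units -/

/-- Modulo `p` every `p`-adic integer is a natural number, and a ring homomorphism to `ZMod p` kills
`p`, so there is only one. -/
theorem ringHom_apply_eq_toZMod (f : ℤ_[p] →+* ZMod p) (x : ℤ_[p]) : f x = PadicInt.toZMod x := by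
  have key (f : ℤ_[p] →+* ZMod p) : f x = (x.zmodRepr : ZMod p) := by
    have hx := PadicInt.sub_zmodRepr_mem x
    rw [PadicInt.maximalIdeal_eq_span_p] at hx
    obtain ⟨y, hy⟩ := Ideal.mem_span_singleton.mp hx
    have h : f (x - x.zmodRepr) = f (p * y) := congrArg f hy
    rw [map_sub, map_mul, map_natCast, map_natCast, ZMod.natCast_self, zero_mul] at h
    exact sub_eq_zero.mp h
  rw [key, key]

theorem toZMod_eq_zero_iff_dvd (a : ℤ_[p]) : PadicInt.toZMod a = 0 ↔ (p : ℤ_[p]) ∣ a := by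
  rw [← RingHom.mem_ker, PadicInt.ker_toZMod, PadicInt.maximalIdeal_eq_span_p,
    Ideal.mem_span_singleton]

theorem isUnit_iff_toZMod_ne_zero (a : ℤ_[p]) : IsUnit a ↔ PadicInt.toZMod a ≠ 0 := by
  rw [← not_iff_not, not_not, ← RingHom.mem_ker, PadicInt.ker_toZMod,
    IsLocalRing.mem_maximalIdeal, mem_nonunits_iff]

theorem castHom_toZModPow_one (a : ℤ_[p]) :
    ZMod.castHom (dvd_pow_self p (Nat.succ_ne_zero 0)) (ZMod p) (PadicInt.toZModPow (0 + 1) a) =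
      PadicInt.toZMod a :=
  ringHom_apply_eq_toZMod
    ((ZMod.castHom (dvd_pow_self p (Nat.succ_ne_zero 0)) (ZMod p)).comp
      (PadicInt.toZModPow (0 + 1))) a

theorem isUnit_toZModPow_one_iff (a : ℤ_[p]) :
    IsUnit (PadicInt.toZModPow (0 + 1) a) ↔ PadicInt.toZMod a ≠ 0 := by
  refine ⟨fun h ↦ ?_, fun h ↦ ((isUnit_iff_toZMod_ne_zero a).mpr h).map _⟩
  rw [← castHom_toZModPow_one]
  exact (h.map _).ne_zero

theorem omega_apply_of_ne_zero {a : ℤ_[p]} (ha : PadicInt.toZMod a ≠ 0) :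
    omega p 0 (PadicInt.toZModPow (0 + 1) a) =
      intEmb (teichmullerLift p (PadicInt.toZMod a)) := by
  obtain ⟨x, hx⟩ := (isUnit_toZModPow_one_iff a).mpr ha
  rw [← castHom_toZModPow_one, ← hx, omega, DirichletCharacter.changeLevel_eq_cast_of_dvd]
  rfl

theorem omega_pow_apply_of_ne_zero (e : ℕ) {a : ℤ_[p]} (ha : PadicInt.toZMod a ≠ 0) :
    (omega p 0 ^ e) (PadicInt.toZModPow (0 + 1) a) =
      intEmb (teichmullerLift p (PadicInt.toZMod a)) ^ e := by
  have h := omega_apply_of_ne_zero ha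
  obtain ⟨x, hx⟩ := (isUnit_toZModPow_one_iff a).mpr ha
  rw [← hx] at h ⊢
  rw [MulChar.pow_apply_coe, h]

theorem teichmullerLift_inv {x : ZMod p} (hx : x ≠ 0) :
    teichmullerLift p x * teichmullerLift p x⁻¹ = 1 := by
  rw [← map_mul, mul_inv_cancel₀ hx, map_one]

theorem isUnit_teichmullerLift {x : ZMod p} (hx : x ≠ 0) : IsUnit (teichmullerLift p x) :=
  IsUnit.of_mul_eq_one _ (teichmullerLift_inv hx)

/-- The `ℤ_p`-valued function `ω ^ e`, extended by zero to the non-units. -/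
def charLift (e : ℕ) (a : ℤ_[p]) : ℤ_[p] :=
  if PadicInt.toZMod a = 0 then 0 else teichmullerLift p (PadicInt.toZMod a) ^ e

/-- The projection of a `p`-adic unit to the principal units. -/
def principalPart (a : ℤ_[p]) : ℤ_[p] := a * teichmullerLift p (PadicInt.toZMod a)⁻¹

theorem extendChar_omega_pow (e : ℕ) (a : ℤ_[p]) :
    extendChar (omega p 0 ^ e) a = intEmb (charLift e a) := by
  rw [charLift, extendChar]
  split_ifs with h
  · rw [map_zero]
    exact MulChar.map_nonunit _ fun hu ↦ (isUnit_toZModPow_one_iff a).mp hu h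
  · rw [omega_pow_apply_of_ne_zero e h, map_pow]

theorem coe_teichmullerLift_ne_zero {x : ZMod p} (hx : x ≠ 0) :
    ((teichmullerLift p x : ℤ_[p]) : ℚ_[p]) ≠ 0 :=
  fun h ↦ (isUnit_teichmullerLift hx).ne_zero (Subtype.ext h)

theorem coe_principalPart {a : ℤ_[p]} (ha : PadicInt.toZMod a ≠ 0) :
    ((principalPart a : ℤ_[p]) : ℚ_[p]) = angle a := by
  have h0 : a ≠ 0 := by
    rintro rfl
    exact ha (map_zero _)
  have hv : a.valuation = 0 := by
    have h1 := PadicInt.isUnit_iff.mp ((isUnit_iff_toZMod_ne_zero a).mpr ha)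
    rw [PadicInt.norm_eq_zpow_neg_valuation h0] at h1
    have hp1 : (1 : ℝ) < p := by exact_mod_cast hp.out.one_lt
    have := (zpow_eq_one_iff_right₀ (by positivity) hp1.ne').mp h1
    omega
  have hu : (PadicInt.unitCoeff h0 : ℤ_[p]) = a := by
    have := PadicInt.unitCoeff_spec h0
    rw [hv, pow_zero, mul_one] at this
    exact this.symm
  rw [angle, dif_neg h0, hu, eq_div_iff (coe_teichmullerLift_ne_zero ha), ← PadicInt.coe_mul,
    principalPart, mul_assoc, mul_comm (teichmullerLift p _), teichmullerLift_inv ha, mul_one]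

theorem prime_dvd_principalPart_sub_one {a : ℤ_[p]} (ha : PadicInt.toZMod a ≠ 0) :
    (p : ℤ_[p]) ∣ principalPart a - 1 := by
  rw [← toZMod_eq_zero_iff_dvd, map_sub, principalPart, map_mul, toZMod_teichmullerLift, map_one,
    mul_inv_cancel₀ ha, sub_self]

theorem norm_le_inv_of_prime_dvd {x : ℤ_[p]} (h : (p : ℤ_[p]) ∣ x) : ‖x‖ ≤ (p : ℝ)⁻¹ := by
  obtain ⟨y, rfl⟩ := h
  rw [norm_mul, PadicInt.norm_p]
  exact mul_le_of_le_one_right (by positivity) (PadicInt.norm_le_one _)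

theorem norm_angle_sub_one_le {a : ℤ_[p]} (ha : a ≠ 0) :
    ‖algebraMap ℚ_[p] ℂ_[p] (angle a) - 1‖ ≤ (p : ℝ)⁻¹ := by
  have hu : PadicInt.toZMod (PadicInt.unitCoeff ha : ℤ_[p]) ≠ 0 :=
    (isUnit_iff_toZMod_ne_zero _).mp (PadicInt.unitCoeff ha).isUnit
  have h : angle a = ((principalPart (PadicInt.unitCoeff ha : ℤ_[p]) : ℤ_[p]) : ℚ_[p]) := by
    rw [angle, dif_neg ha, principalPart, div_eq_iff (coe_teichmullerLift_ne_zero hu),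
      ← PadicInt.coe_mul, mul_assoc, mul_comm (teichmullerLift p _), teichmullerLift_inv hu,
      mul_one]
  have h2 : algebraMap ℚ_[p] ℂ_[p] (angle a) - 1 =
      intEmb (principalPart (PadicInt.unitCoeff ha : ℤ_[p]) - 1) := by
    rw [h, map_sub, map_one, intEmb_apply]
  rw [h2, norm_intEmb]
  exact norm_le_inv_of_prime_dvd (prime_dvd_principalPart_sub_one hu)

theorem summable_anglePowTerm (hp2 : p ≠ 2) {a : ℤ_[p]} (ha : a ≠ 0) {t : ℂ_[p]} (ht : ‖t‖ ≤ 1) :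
    Summable (anglePowTerm a t) := by
  refine Summable.of_norm_bounded (summable_ratio_pow (p := p)) fun n ↦ ?_
  rw [anglePowTerm, norm_mul, norm_pow, mul_comm]
  refine le_trans ?_ (norm_choose_le hp2 ht n)
  gcongr
  exact norm_angle_sub_one_le ha

/-! ### The coefficients of the binomial expansion of the integrand -/

/-- The function `ω ^ e (a) (⟨a⟩ - 1) ^ n`, supported on the `p`-adic units. -/
def binomialCoeffFun (e n : ℕ) (a : ℤ_[p]) : ℤ_[p] := charLift e a * (principalPart a - 1) ^ n

theorem hasSum_hurwitzIntegrand (hp2 : p ≠ 2) (e : ℕ) {t : ℂ_[p]} (ht : ‖t‖ ≤ 1) (a : ℤ_[p]) :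
    HasSum (fun n ↦ Ring.choose t n * intEmb (binomialCoeffFun e n a))
      (hurwitzIntegrand (1 - t) (omega p 0 ^ e) 0 a) := by
  rw [hurwitzIntegrand, zero_add a, sub_sub_cancel, extendChar_omega_pow]
  by_cases h : PadicInt.toZMod a = 0
  · have hc : charLift e a = 0 := if_pos h
    simp [binomialCoeffFun, hc, hasSum_zero]
  · have h0 : a ≠ 0 := by
      rintro rfl
      exact h (map_zero _)
    convert! (summable_anglePowTerm hp2 h0 ht).hasSum.mul_left (intEmb (charLift e a)) using 2 with n
    rw [anglePowTerm, ← coe_principalPart h, ← intEmb_apply, binomialCoeffFun, map_mul, map_pow,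
      map_sub, map_one]
    ring

/-- On units `h(a) = (⟨a⟩ - 1) / p`. The division by `p` loses one power in the congruences, hence
`N + 1` against `N`. -/
theorem binomialCoeffFun_eq_pow_mul (e : ℕ) : ∃ h : ℤ_[p] → ℤ_[p],
    (∀ n a, binomialCoeffFun e n a = (p : ℤ_[p]) ^ n * (charLift e a * h a ^ n)) ∧
    ∀ (n N : ℕ) (a b : ℤ_[p]), (p : ℤ_[p]) ^ (N + 1) ∣ a - b →
      (p : ℤ_[p]) ^ N ∣ charLift e a * h a ^ n - charLift e b * h b ^ n := by
  -- Off the units the value of `h` is irrelevant, because `charLift` vanishes there.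
  have hex : ∀ a : ℤ_[p], ∃ y : ℤ_[p], PadicInt.toZMod a ≠ 0 → principalPart a - 1 = p * y := by
    intro a
    by_cases ha : PadicInt.toZMod a = 0
    · exact ⟨0, fun h ↦ (h ha).elim⟩
    · obtain ⟨y, hy⟩ := prime_dvd_principalPart_sub_one ha
      exact ⟨y, fun _ ↦ hy⟩
  choose h hh using hex
  refine ⟨h, fun n a ↦ ?_, fun n N a b hab ↦ ?_⟩
  · by_cases ha : PadicInt.toZMod a = 0
    · have hc : charLift e a = 0 := if_pos ha
      simp [binomialCoeffFun, hc]
    · rw [binomialCoeffFun, hh a ha]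
      ring
  · have hz : PadicInt.toZMod a = PadicInt.toZMod b := by
      rw [← sub_eq_zero, ← map_sub, toZMod_eq_zero_iff_dvd]
      exact (dvd_pow_self _ (Nat.succ_ne_zero N)).trans hab
    have hc : charLift e a = charLift e b := by rw [charLift, charLift, hz]
    by_cases ha : PadicInt.toZMod a = 0
    · have hc0 : charLift e a = 0 := if_pos ha
      rw [← hc, hc0]
      simp
    · have hb : PadicInt.toZMod b ≠ 0 := hz ▸ ha
      rw [hc, ← mul_sub]
      refine Dvd.dvd.mul_left (dvd_trans ?_ (sub_dvd_pow_sub_pow _ _ n)) _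
      -- Congruent units have the same Teichmüller factor, so `p (h a - h b)` is a multiple of `a -
      -- b`.
      have h1 : (p : ℤ_[p]) * (h a - h b) = (a - b) * teichmullerLift p (PadicInt.toZMod b)⁻¹ := by
        rw [mul_sub, ← hh a ha, ← hh b hb, principalPart, principalPart, hz]
        ring
      have h2 : (p : ℤ_[p]) * p ^ N ∣ p * (h a - h b) := by
        rw [h1, ← pow_succ']
        exact hab.mul_right _
      exact (mul_dvd_mul_iff_left (Nat.cast_ne_zero.mpr hp.out.ne_zero)).mp h2

theorem volkenbornSum_const_mul (c : ℂ_[p]) (f : ℤ_[p] → ℂ_[p]) (N : ℕ) :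
    volkenbornSum (fun a ↦ c * f a) N = c * volkenbornSum f N := by
  rw [volkenbornSum, volkenbornSum, ← Finset.mul_sum, mul_left_comm]

theorem norm_volkenbornSum_binomialCoeffFun_le (e n N : ℕ) :
    ‖volkenbornSum (fun a ↦ (intEmb (binomialCoeffFun e n a) : ℂ_[p])) N‖ ≤
      (p : ℝ) ^ 2 * ((p : ℝ)⁻¹) ^ n := by
  obtain ⟨h, h1, h2⟩ := binomialCoeffFun_eq_pow_mul (p := p) e
  simp only [h1, map_mul, map_pow, map_natCast]
  rw [volkenbornSum_const_mul, norm_mul, norm_pow, norm_prime, mul_comm]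
  refine mul_le_mul_of_nonneg_right ?_ (by positivity)
  simp only [← map_pow, ← map_mul]
  exact norm_volkenbornSum_le_of_lipschitz _ (h2 n) N

theorem charLift_mul_principalPart_pow (e m a : ℕ) :
    intEmb (charLift e (a : ℤ_[p]) * principalPart (a : ℤ_[p]) ^ m) =
      (omega p 0 ^ e * (omega p 0 ^ m)⁻¹) (a : ZMod (p ^ (0 + 1))) * (a : ℂ_[p]) ^ m := by
  rw [← map_natCast (PadicInt.toZModPow (p := p) (0 + 1)) a]
  by_cases ha : PadicInt.toZMod (a : ℤ_[p]) = 0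
  · have hc : charLift e (a : ℤ_[p]) = 0 := if_pos ha
    have hu : ¬IsUnit (PadicInt.toZModPow (0 + 1) (a : ℤ_[p])) :=
      fun hu ↦ (isUnit_toZModPow_one_iff _).mp hu ha
    rw [hc, MulChar.map_nonunit _ hu]
    simp
  · have hc : charLift e (a : ℤ_[p]) = teichmullerLift p (PadicInt.toZMod (a : ℤ_[p])) ^ e :=
      if_neg ha
    have hi := congrArg (intEmb (p := p)) (teichmullerLift_inv ha)
    rw [map_mul, map_one] at hi
    rw [MulChar.mul_apply, MulChar.inv_apply_eq_inv', omega_pow_apply_of_ne_zero e ha,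
      omega_pow_apply_of_ne_zero m ha, hc, principalPart, ← inv_pow, inv_eq_of_mul_eq_one_right hi]
    simp only [map_mul, map_pow, map_natCast]
    ring

theorem tendsto_volkenbornSum_pow (e m : ℕ) :
    Tendsto (volkenbornSum fun a : ℤ_[p] ↦ intEmb (charLift e a * principalPart a ^ m)) atTop
      (𝓝 (interpolationValue (omega p 0 ^ e) m)) := by
  rw [interpolationValue_eq]
  refine (tendsto_eulerBernoulli (pow_one p) _ m).congr fun N ↦ ?_
  rw [volkenbornSum]
  simp only [charLift_mul_principalPart_pow]

/-- The coefficients of the interpolation series. -/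
def interpolationCoeff (p : ℕ) [Fact p.Prime] (e n : ℕ) : ℂ_[p] :=
  (fwdDiff 1)^[n] (interpolationValue (omega p 0 ^ e)) 0

/-- Expanding `(⟨a⟩ - 1)^n` produces the same signed binomial coefficients as the `n`-th forward
difference of `m ↦ b_m` at 0. -/
theorem tendsto_volkenbornSum_binomialCoeffFun (e n : ℕ) :
    Tendsto (volkenbornSum fun a : ℤ_[p] ↦ intEmb (binomialCoeffFun e n a)) atTop
      (𝓝 (interpolationCoeff p e n)) := by
  rw [interpolationCoeff, fwdDiff_iter_eq_sum_shift]
  refine (tendsto_finsetSum (Finset.range (n + 1)) fun k _ ↦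
    ((tendsto_volkenbornSum_pow (p := p) e (0 + k • 1)).const_smul
      ((-1 : ℤ) ^ (n - k) * n.choose k))).congr fun N ↦ ?_
  simp only [volkenbornSum, zsmul_eq_mul, mul_left_comm (_ : ℂ_[p]) ((p ^ N : ℂ_[p])⁻¹),
    ← Finset.mul_sum]
  congr 1
  simp only [Finset.mul_sum]
  rw [Finset.sum_comm]
  refine Finset.sum_congr rfl fun a _ ↦ ?_
  rw [binomialCoeffFun, sub_eq_add_neg, add_pow, Finset.mul_sum, map_sum]
  refine Finset.sum_congr rfl fun k _ ↦ ?_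
  simp only [map_mul, map_pow, map_neg, map_one, map_natCast, zero_add, smul_eq_mul, mul_one]
  push_cast
  ring

theorem norm_interpolationCoeff_le (e n : ℕ) :
    ‖interpolationCoeff p e n‖ ≤ (p : ℝ) ^ 2 * ((p : ℝ)⁻¹) ^ n :=
  le_of_tendsto (tendsto_volkenbornSum_binomialCoeffFun e n).norm
    (.of_forall fun N ↦ norm_volkenbornSum_binomialCoeffFun_le e n N)

/-- The function `A(t) = ∑ c_n binom(t, n)` attached to `ω ^ e`. -/
def interpolant (p : ℕ) [Fact p.Prime] (e : ℕ) (t : ℂ_[p]) : ℂ_[p] :=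
  ∑' n : ℕ, interpolationTerm (omega p 0 ^ e) t n

theorem interpolationTerm_eq (e n : ℕ) (t : ℂ_[p]) :
    interpolationTerm (omega p 0 ^ e) t n = interpolationCoeff p e n * Ring.choose t n := rfl

theorem interpolant_natCast (e n : ℕ) :
    interpolant p e n = interpolationValue (omega p 0 ^ e) n :=
  tsum_interpolationTerm_natCast _ n

theorem norm_mul_le_ratio_pow {n : ℕ} {c x : ℂ_[p]} (hc : ‖c‖ ≤ (p : ℝ) ^ 2 * ((p : ℝ)⁻¹) ^ n)
    (hx : ((p : ℝ)⁻¹) ^ n * ‖x‖ ≤ ratio p ^ n) : ‖c * x‖ ≤ (p : ℝ) ^ 2 * ratio p ^ n := by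
  rw [norm_mul]
  calc ‖c‖ * ‖x‖ ≤ (p : ℝ) ^ 2 * ((p : ℝ)⁻¹) ^ n * ‖x‖ := by gcongr
    _ ≤ _ := by
      rw [mul_assoc]
      gcongr

theorem summable_interpolationTerm (hp2 : p ≠ 2) (e : ℕ) {t : ℂ_[p]} (ht : ‖t‖ ≤ 1) :
    Summable (interpolationTerm (omega p 0 ^ e) t) :=
  Summable.of_norm_bounded ((summable_ratio_pow (p := p)).mul_left ((p : ℝ) ^ 2)) fun n ↦
    norm_mul_le_ratio_pow (norm_interpolationCoeff_le e n) (norm_choose_le hp2 ht n)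

theorem volkenbornSum_hurwitzIntegrand (hp2 : p ≠ 2) (e : ℕ) {t : ℂ_[p]} (ht : ‖t‖ ≤ 1) (N : ℕ) :
    volkenbornSum (hurwitzIntegrand (1 - t) (omega p 0 ^ e) 0) N =
      ∑' n : ℕ, volkenbornSum (fun a ↦ intEmb (binomialCoeffFun e n a)) N * Ring.choose t n := by
  have h := (hasSum_sum fun (a : ℕ) (_ : a ∈ Finset.range (p ^ N)) ↦
    hasSum_hurwitzIntegrand hp2 e ht (a : ℤ_[p])).mul_left ((p : ℂ_[p]) ^ N)⁻¹
  rw [volkenbornSum, ← h.tsum_eq]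
  refine tsum_congr fun n ↦ ?_
  rw [volkenbornSum, ← Finset.mul_sum]
  ring

/-- The majorant `p^2 p^(-n/2)` does not depend on `N`, so the limit may be taken term by term. -/
theorem tendsto_volkenbornSum_hurwitzIntegrand (hp2 : p ≠ 2) (e : ℕ) {t : ℂ_[p]} (ht : ‖t‖ ≤ 1) :
    Tendsto (volkenbornSum (hurwitzIntegrand (1 - t) (omega p 0 ^ e) 0)) atTop
      (𝓝 (interpolant p e t)) := by
  simp only [funext (volkenbornSum_hurwitzIntegrand hp2 e ht)]
  exact tendsto_tsum_of_dominated_convergence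
    ((summable_ratio_pow (p := p)).mul_left ((p : ℝ) ^ 2))
    (fun n ↦ (tendsto_volkenbornSum_binomialCoeffFun e n).mul_const _)
    (.of_forall fun N n ↦ norm_mul_le_ratio_pow (norm_volkenbornSum_binomialCoeffFun_le e n N)
      (norm_choose_le hp2 ht n))

theorem volkenbornIntegral_hurwitzIntegrand (hp2 : p ≠ 2) (e : ℕ) {t : ℂ_[p]} (ht : ‖t‖ ≤ 1) :
    volkenbornIntegral (hurwitzIntegrand (1 - t) (omega p 0 ^ e) 0) = interpolant p e t :=
  (tendsto_volkenbornSum_hurwitzIntegrand hp2 e ht).limUnder_eq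

/-- The function `(A(t) - A(0)) / t`, extended by continuity to `t = 0`. -/
def interpolantSlope (p : ℕ) [Fact p.Prime] (e : ℕ) (t : ℂ_[p]) : ℂ_[p] :=
  ∑' n : ℕ, interpolationCoeff p e (n + 1) * (Ring.choose (t - 1) n / (n + 1))

theorem continuousOn_interpolantSlope (hp2 : p ≠ 2) (e : ℕ) :
    ContinuousOn (interpolantSlope p e) {t | ‖t‖ ≤ 1} := by
  refine continuousOn_tsum (fun n ↦ ?_)
    (((summable_nat_add_iff 1).mpr (summable_ratio_pow (p := p))).mul_left ((p : ℝ) ^ 2))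
    fun n t ht ↦ norm_mul_le_ratio_pow (norm_interpolationCoeff_le e (n + 1))
      (norm_choose_sub_one_div_le hp2 ht n)
  exact (continuous_const.mul (((continuous_choose n).comp
    (continuous_id.sub continuous_const)).div_const _)).continuousOn

/-- Each `binom(t, n + 1)` contains the factor `t`; the remaining term is `c_0 = A(0)`. -/
theorem interpolant_eq (hp2 : p ≠ 2) (e : ℕ) {t : ℂ_[p]} (ht : ‖t‖ ≤ 1) :
    interpolant p e t = interpolant p e 0 + t * interpolantSlope p e t := by
  have h0 : interpolant p e 0 = interpolationCoeff p e 0 := by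
    have := interpolant_natCast (p := p) e 0
    rw [Nat.cast_zero] at this
    exact this
  rw [interpolant, (summable_interpolationTerm hp2 e ht).tsum_eq_zero_add, h0, interpolationTerm_eq,
    Ring.choose_zero_right, mul_one, interpolantSlope, ← tsum_mul_left]
  congr 1
  refine tsum_congr fun n ↦ ?_
  rw [interpolationTerm_eq, choose_succ_right]
  ring

theorem continuousOn_interpolant (hp2 : p ≠ 2) (e : ℕ) :
    ContinuousOn (interpolant p e) {t | ‖t‖ ≤ 1} :=
  (continuousOn_const.add (continuousOn_id.mul (continuousOn_interpolantSlope hp2 e))).congr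
    fun _ ht ↦ interpolant_eq hp2 e ht

/-! ### Special values of the interpolating function -/

theorem generalizedBernoulli_zero {ψ : DirichletCharacter ℂ_[p] p} (hψ : ψ ≠ 1) :
    generalizedBernoulli ψ 0 = 0 := by
  have h : ∑ r ∈ Finset.range p, ψ (r : ZMod p) = ∑ x : ZMod p, ψ x :=
    Finset.sum_bij' (fun r _ ↦ (r : ZMod p)) (fun x _ ↦ x.val) (by simp)
      (fun x _ ↦ Finset.mem_range.mpr x.val_lt)
      (fun r hr ↦ ZMod.val_cast_of_lt (Finset.mem_range.mp hr)) (by simp) (by simp)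
  rw [generalizedBernoulli_prime_level]
  simp [h, MulChar.sum_eq_zero_of_ne_one hψ]

theorem eulerBernoulli_primitiveCharacter_zero {f : ℕ} (hf : f = p)
    {ψ : DirichletCharacter ℂ_[p] f} (hψ : ψ ≠ 1) :
    eulerBernoulli ψ.primitiveCharacter 0 = 0 := by
  subst hf
  rw [eulerBernoulli_primitiveCharacter_of_ne_one hψ, generalizedBernoulli_zero hψ]

/-- Modulo `p` the character `ω` is the identity, so `ω^e = 1` would force `x^e = 1` on the cyclic
group of order `p - 1`. -/
theorem omega_pow_ne_one {e : ℕ} (he : ¬(p - 1) ∣ e) : omega p 0 ^ e ≠ 1 := by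
  intro h
  have key : ∀ x : (ZMod p)ˣ, x ^ e = 1 := by
    intro x
    obtain ⟨a, ha⟩ := ZMod.ringHom_surjective (PadicInt.toZMod (p := p)) (x : ZMod p)
    have ha0 : PadicInt.toZMod a ≠ 0 := ha ▸ x.ne_zero
    have h1 := omega_pow_apply_of_ne_zero e ha0
    rw [h, MulChar.one_apply ((isUnit_toZModPow_one_iff a).mpr ha0), intEmb_apply, ← map_pow] at h1
    have h2 : ((teichmullerLift p (x : ZMod p) ^ e : ℤ_[p]) : ℚ_[p]) = 1 := by
      apply (algebraMap ℚ_[p] ℂ_[p]).injective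
      rw [map_one, h1, ha, PadicInt.coe_pow]
    have h3 : teichmullerLift p (x : ZMod p) ^ e = 1 := Subtype.ext h2
    have h4 := congrArg PadicInt.toZMod h3
    rw [map_pow, toZMod_teichmullerLift, map_one] at h4
    exact Units.ext (by simpa using h4)
  have := (FiniteField.forall_pow_eq_one_iff (ZMod p) e).mp key
  rw [ZMod.card] at this
  exact he this

theorem omega_pow_eq {e k : ℕ} (h : (e : ZMod (p - 1)) = k) : omega p 0 ^ e = omega p 0 ^ k := by
  have h1 : omega p 0 ^ (p - 1) = 1 := by
    refine MulChar.ext fun x ↦ ?_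
    obtain ⟨a, ha⟩ := ZMod.ringHom_surjective (PadicInt.toZModPow (p := p) (0 + 1)) x
    have ha0 : PadicInt.toZMod a ≠ 0 := (isUnit_toZModPow_one_iff a).mp (ha ▸ x.isUnit)
    rw [MulChar.one_apply_coe, ← ha, omega_pow_apply_of_ne_zero _ ha0, ← map_pow, ← map_pow,
      ZMod.pow_card_sub_one_eq_one ha0, map_one, map_one]
  have h2 : e ≡ k [MOD p - 1] := (ZMod.natCast_eq_natCast_iff _ _ _).mp h
  exact pow_eq_pow_iff_modEq.mpr (h2.of_dvd (orderOf_dvd_of_pow_eq_one h1))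

theorem interpolant_zero {e : ℕ} (he : ¬(p - 1) ∣ e) : interpolant p e 0 = 0 := by
  have h := interpolant_natCast (p := p) e 0
  rw [Nat.cast_zero, interpolationValue_eq, pow_zero, inv_one, mul_one] at h
  rw [h]
  exact eulerBernoulli_primitiveCharacter_zero (pow_one p) (omega_pow_ne_one he)

/-- The twist `ω^(e-k)` is trivial, so `b_k` is an ordinary Bernoulli number with its Euler factor.
The condition `k > 1` avoids the sign ambiguity of `B_1`. -/
theorem interpolant_natCast_of_eq {e k : ℕ} (hk : 1 < k) (h : (e : ZMod (p - 1)) = k) :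
    interpolant p e k = (1 - (p : ℂ_[p]) ^ (k - 1)) * ((bernoulli k : ℚ) : ℂ_[p]) := by
  have hne : NeZero (p ^ (0 + 1)) := ⟨pow_ne_zero _ hp.out.ne_zero⟩
  rw [interpolant_natCast, interpolationValue_eq, omega_pow_eq h, mul_inv_cancel,
    eulerBernoulli_level_one DirichletCharacter.conductor_one]
  have h1 := aeval_ratCast (p := p) (Polynomial.bernoulli k) 1
  rw [Rat.cast_one] at h1
  rw [h1, Polynomial.bernoulli_eval_one, bernoulli_eq_bernoulli'_of_ne_one hk.ne',
    show (k : ℤ) - 1 = ((k - 1 : ℕ) : ℤ) by omega, zpow_natCast]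

/-! ### The weight filter -/

theorem even_val {n : ℕ} [NeZero n] (hn : Even n) {u : ZMod n} (hu : Even u) : Even u.val := by
  obtain ⟨v, rfl⟩ := hu
  rw [ZMod.val_add, Nat.even_iff, Nat.mod_mod_of_dvd _ hn.two_dvd, ← Nat.even_iff]
  exact ⟨v.val, rfl⟩

theorem tendsto_appr (y : ℤ_[p]) : Tendsto (fun N : ℕ ↦ (y.appr N : ℤ_[p])) atTop (𝓝 y) := by
  rw [tendsto_iff_norm_sub_tendsto_zero]
  have h : Tendsto (fun N : ℕ ↦ ((p : ℝ)⁻¹) ^ N) atTop (𝓝 0) :=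
    tendsto_pow_atTop_nhds_zero_of_lt_one (by positivity)
      (inv_lt_one_of_one_lt₀ (by exact_mod_cast hp.out.one_lt))
  refine squeeze_zero (fun _ ↦ norm_nonneg _) (fun N ↦ ?_) h
  rw [norm_sub_rev, inv_pow, ← zpow_natCast, ← zpow_neg]
  exact (PadicInt.norm_le_pow_iff_mem_span_pow _ N).mpr (PadicInt.appr_spec N y)

/-- Nontriviality of the filter makes the limit defining `G*_{s,u}` unique. Suitable weights are `u
+ (p - 1) m` with `m` tending `p`-adically to `(s - u) / (p - 1)`; they are even because `p - 1` is.
-/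
theorem neBot_weightFilter (hp2 : p ≠ 2) (s : ℤ_[p]) {u : ZMod (p - 1)} (hu : Even u) :
    (weightFilter s u).NeBot := by
  have h2 := hp.out.two_le
  have : NeZero (p - 1) := ⟨by omega⟩
  have heven : Even (p - 1) := hp.out.even_sub_one hp2
  have hunit : IsUnit ((p - 1 : ℕ) : ℤ_[p]) := by
    rw [isUnit_iff_toZMod_ne_zero, map_natCast, Ne, ZMod.natCast_eq_zero_iff]
    exact Nat.not_dvd_of_pos_of_lt (by omega) (by omega)
  obtain ⟨d, hd⟩ := hunit
  set y : ℤ_[p] := (d⁻¹ : ℤ_[p]ˣ) * (s - u.val) with hy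
  -- The summand `p^N` forces `m N → ∞`, even if the approximations to `y` stay bounded, without
  -- changing the `p`-adic limit.
  let m : ℕ → ℕ := fun N ↦ y.appr N + p ^ N
  have hm : Tendsto (fun N ↦ (m N : ℤ_[p])) atTop (𝓝 y) := by
    have h : Tendsto (fun N : ℕ ↦ (p : ℤ_[p]) ^ N) atTop (𝓝 0) := by
      apply tendsto_pow_atTop_nhds_zero_of_norm_lt_one
      rw [PadicInt.norm_p]
      exact inv_lt_one_of_one_lt₀ (by exact_mod_cast hp.out.one_lt)
    simpa [m] using (tendsto_appr y).add h
  refine Tendsto.neBot (f := fun N ↦ u.val + (p - 1) * m N) (x := atTop)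
    (tendsto_inf.mpr ⟨tendsto_inf.mpr ⟨?_, tendsto_comap_iff.mpr ?_⟩, tendsto_principal.mpr ?_⟩)
  · refine tendsto_atTop_mono (fun N ↦ ?_) tendsto_id
    calc N ≤ p ^ N := (Nat.lt_pow_self hp.out.one_lt).le
      _ ≤ m N := Nat.le_add_left _ _
      _ ≤ (p - 1) * m N := Nat.le_mul_of_pos_left _ (by omega)
      _ ≤ _ := Nat.le_add_left _ _
  · have h := (hm.const_mul ((p - 1 : ℕ) : ℤ_[p])).const_add ((u.val : ℕ) : ℤ_[p])
    rw [← hd, hy, Units.mul_inv_cancel_left, add_sub_cancel] at h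
    refine h.congr fun N ↦ ?_
    rw [Function.comp_apply, hd]
    push_cast
    rfl
  · refine .of_forall fun N ↦ ⟨(even_val heven hu).add (heven.mul_right _), ?_⟩
    rw [Nat.cast_add, Nat.cast_mul, ZMod.natCast_self, zero_mul, add_zero, ZMod.natCast_zmod_val]

theorem weightFilter_le_atTop (s : ℤ_[p]) (u : ZMod (p - 1)) : weightFilter s u ≤ atTop :=
  inf_le_left.trans inf_le_left

theorem eventually_natCast_eq (s : ℤ_[p]) (u : ZMod (p - 1)) :
    ∀ᶠ k : ℕ in weightFilter s u, (k : ZMod (p - 1)) = u :=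
  (inf_le_right : weightFilter s u ≤ _) (mem_principal.mpr fun _ h ↦ h.2)

theorem continuous_intEmb : Continuous (intEmb : ℤ_[p] → ℂ_[p]) :=
  (AddMonoidHomClass.isometry_of_norm intEmb norm_intEmb).continuous

theorem tendsto_natCast_weightFilter (s : ℤ_[p]) (u : ZMod (p - 1)) :
    Tendsto (fun k : ℕ ↦ (k : ℂ_[p])) (weightFilter s u) (𝓝[{t | ‖t‖ ≤ 1}] (intEmb s)) := by
  refine tendsto_nhdsWithin_iff.mpr ⟨?_, .of_forall norm_natCast_le_one⟩
  have h : Tendsto (fun k : ℕ ↦ (k : ℤ_[p])) (weightFilter s u) (𝓝 s) :=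
    tendsto_comap.mono_left (inf_le_left.trans inf_le_right)
  simpa [Function.comp_def] using (continuous_intEmb.tendsto s).comp h

/-! ### Constant terms of Eisenstein series -/

theorem norm_intEmb_le_one (s : ℤ_[p]) : ‖(intEmb s : ℂ_[p])‖ ≤ 1 :=
  (norm_intEmb s).trans_le (PadicInt.norm_le_one s)

/-- The quotient `A(t) / t`, continuously extended to `t = 0` if `A(0) = 0`. -/
def interpolantQuotient (p : ℕ) [Fact p.Prime] (e : ℕ) (t : ℂ_[p]) : ℂ_[p] :=
  letI := Classical.decEq ℂ_[p]
  if t = 0 then interpolantSlope p e 0 else t⁻¹ * interpolant p e t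

theorem interpolantQuotient_zero (e : ℕ) :
    interpolantQuotient p e 0 = interpolantSlope p e 0 := if_pos rfl

theorem interpolantQuotient_of_ne_zero (e : ℕ) {t : ℂ_[p]} (ht : t ≠ 0) :
    interpolantQuotient p e t = t⁻¹ * interpolant p e t := if_neg ht

theorem inv_mul_interpolant (hp2 : p ≠ 2) {e : ℕ} (he : interpolant p e 0 = 0) {t : ℂ_[p]}
    (ht : ‖t‖ ≤ 1) (h0 : t ≠ 0) : t⁻¹ * interpolant p e t = interpolantSlope p e t := by
  rw [interpolant_eq hp2 e ht, he, zero_add, inv_mul_cancel_left₀ h0]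

theorem tendsto_inv_mul_interpolant (hp2 : p ≠ 2) {s : ℤ_[p]} {u : ZMod (p - 1)} {e : ℕ}
    (he : s = 0 → interpolant p e 0 = 0) :
    Tendsto (fun k : ℕ ↦ (k : ℂ_[p])⁻¹ * interpolant p e k) (weightFilter s u)
      (𝓝 (interpolantQuotient p e (intEmb s))) := by
  have hk := tendsto_natCast_weightFilter s u
  by_cases hs : s = 0
  · subst hs
    rw [map_zero] at hk ⊢
    rw [interpolantQuotient_zero]
    have hc := (continuousOn_interpolantSlope hp2 e) 0 (by simp)
    refine (hc.tendsto.comp hk).congr' ?_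
    filter_upwards [weightFilter_le_atTop _ _ (eventually_ne_atTop 0)] with k hk0
    exact (inv_mul_interpolant hp2 (he rfl) (norm_natCast_le_one k)
      (Nat.cast_ne_zero.mpr hk0)).symm
  · have hs0 : (intEmb s : ℂ_[p]) ≠ 0 := by
      rw [← norm_ne_zero_iff, norm_intEmb, norm_ne_zero_iff]
      exact hs
    rw [interpolantQuotient_of_ne_zero e hs0]
    have hc := (continuousOn_interpolant hp2 e) _ (norm_intEmb_le_one s)
    exact ((tendsto_nhds_of_tendsto_nhdsWithin hk).inv₀ hs0).mul (hc.tendsto.comp hk)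

theorem algebraMap_coeff_zero_eisensteinQExp {e k : ℕ} (hk : 1 < k)
    (h : (e : ZMod (p - 1)) = k) :
    algebraMap ℚ_[p] ℂ_[p] ((PowerSeries.coeff 0 (eisensteinQExp k) : ℚ) : ℚ_[p]) =
      -(1 / 2) * ((k : ℂ_[p])⁻¹ * interpolant p e k) * (1 - (p : ℂ_[p]) ^ (k - 1))⁻¹ := by
  have hk0 : (k : ℂ_[p]) ≠ 0 := Nat.cast_ne_zero.mpr (by omega)
  have h1 : (1 - (p : ℂ_[p]) ^ (k - 1)) ≠ 0 := by
    rw [sub_ne_zero]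
    intro h1
    have h2 : 1 = p ^ (k - 1) := by exact_mod_cast h1
    exact (Nat.one_lt_pow (by omega) hp.out.one_lt).ne h2
  rw [interpolant_natCast_of_eq hk h, eisensteinQExp, PowerSeries.coeff_mk, if_pos rfl,
    map_ratCast]
  push_cast
  field_simp

theorem tendsto_algebraMap_coeff_zero (hp2 : p ≠ 2) {s : ℤ_[p]} {u : ZMod (p - 1)} {e : ℕ}
    (hu : (e : ZMod (p - 1)) = u) (he : s = 0 → interpolant p e 0 = 0) :
    Tendsto (fun k : ℕ ↦ algebraMap ℚ_[p] ℂ_[p]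
        ((PowerSeries.coeff 0 (eisensteinQExp k) : ℚ) : ℚ_[p])) (weightFilter s u)
      (𝓝 (-(1 / 2) * interpolantQuotient p e (intEmb s))) := by
  -- The Euler factor disappears because `k → ∞` also in the usual order.
  have h1 : Tendsto (fun k : ℕ ↦ (1 - (p : ℂ_[p]) ^ (k - 1))⁻¹) (weightFilter s u) (𝓝 1) := by
    have := ((tendsto_prime_pow (p := p)).comp (tendsto_sub_atTop_nat 1)).const_sub 1
    rw [sub_zero] at this
    simpa using (this.inv₀ (by simp)).mono_left (weightFilter_le_atTop s u)
  have h2 := ((tendsto_inv_mul_interpolant hp2 he (u := u)).const_mul (-(1 / 2))).mul h1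
  rw [mul_one] at h2
  refine h2.congr' ?_
  filter_upwards [weightFilter_le_atTop s u (eventually_gt_atTop 1), eventually_natCast_eq s u]
    with k hk hku
  exact (algebraMap_coeff_zero_eisensteinQExp hk (hu.trans hku.symm)).symm

/-- `ℚ_p` is complete, hence closed in `ℂ_p`, so limits computed in `ℂ_p` descend. -/
theorem exists_tendsto_of_tendsto_algebraMap {ι : Type*} {l : Filter ι} [l.NeBot]
    {f : ι → ℚ_[p]} {y : ℂ_[p]} (h : Tendsto (fun i ↦ algebraMap ℚ_[p] ℂ_[p] (f i)) l (𝓝 y)) :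
    ∃ x, algebraMap ℚ_[p] ℂ_[p] x = y ∧ Tendsto f l (𝓝 x) := by
  have hc : IsClosedEmbedding (algebraMap ℚ_[p] ℂ_[p]) :=
    (algebraMap_isometry ℚ_[p] ℂ_[p]).isClosedEmbedding
  obtain ⟨x, rfl⟩ := hc.isClosed_range.mem_of_tendsto h (.of_forall fun i ↦ ⟨f i, rfl⟩)
  exact ⟨x, rfl, hc.isEmbedding.tendsto_nhds_iff.mpr h⟩

theorem coeff_zero_padicEisenstein (hp2 : p ≠ 2) {s : ℤ_[p]} {u : ZMod (p - 1)} (hue : Even u)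
    {e : ℕ} (hu : (e : ZMod (p - 1)) = u) (he : s = 0 → interpolant p e 0 = 0) :
    algebraMap ℚ_[p] ℂ_[p] (PowerSeries.coeff 0 (padicEisenstein s u)) =
        -(1 / 2) * interpolantQuotient p e (intEmb s) ∧
      Tendsto (fun k : ℕ ↦ ((PowerSeries.coeff 0 (eisensteinQExp k) : ℚ) : ℚ_[p]))
        (weightFilter s u) (𝓝 (PowerSeries.coeff 0 (padicEisenstein s u))) := by
  have := neBot_weightFilter hp2 s hue
  obtain ⟨x, hx, hlim⟩ :=
    exists_tendsto_of_tendsto_algebraMap (tendsto_algebraMap_coeff_zero hp2 hu he)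
  have h : PowerSeries.coeff 0 (padicEisenstein s u) = x := by
    rw [padicEisenstein, PowerSeries.coeff_mk]
    exact hlim.limUnder_eq
  rw [h]
  exact ⟨hx, hlim⟩

/-! ### The zeta function and the `L`-function -/

theorem extendAtOne_of_tendsto {f : ℂ_[p] → ℂ_[p]} {y : ℂ_[p]} (h : Tendsto f (𝓝[≠] 1) (𝓝 y)) :
    extendAtOne f 1 = y ∧ ContinuousAt (extendAtOne f) 1 := by
  classical
  have hl : limUnder (𝓝[≠] 1) f = y := h.limUnder_eq
  refine ⟨by rw [extendAtOne, Function.update_self, hl], ?_⟩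
  rw [extendAtOne, continuousAt_update_same, hl]
  exact h

/-- Treats both functions at once. The formula for `f` is required only for `|t| ≤ 1`, where the
Volkenborn integral has been evaluated; this ball is a neighbourhood of 0, which is enough for the
limit at 1. -/
theorem extendAtOne_interpolant (hp2 : p ≠ 2) {e : ℕ} {f : ℂ_[p] → ℂ_[p]}
    (hf : ∀ t : ℂ_[p], ‖t‖ ≤ 1 → f (1 - t) = (1 - t - 1)⁻¹ * interpolant p e t) {s : ℤ_[p]}
    (he : s = 0 → interpolant p e 0 = 0) :
    extendAtOne f (1 - intEmb s) = -interpolantQuotient p e (intEmb s) ∧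
      (s = 0 → ContinuousAt (extendAtOne f) 1) := by
  by_cases hs : s = 0
  · have hlim : Tendsto f (𝓝[≠] 1) (𝓝 (-interpolantSlope p e 0)) := by
      have hball : {t : ℂ_[p] | ‖t‖ ≤ 1} ∈ 𝓝 (0 : ℂ_[p]) := by
        filter_upwards [Metric.closedBall_mem_nhds (0 : ℂ_[p]) one_pos] with t ht
        simpa using ht
      have hc : ContinuousAt (interpolantSlope p e) 0 :=
        (continuousOn_interpolantSlope hp2 e).continuousAt hball
      have hsub : Tendsto (fun z : ℂ_[p] ↦ 1 - z) (𝓝[≠] 1) (𝓝 0) := by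
        have : Tendsto (fun z : ℂ_[p] ↦ 1 - z) (𝓝 1) (𝓝 (1 - 1)) :=
          (continuous_const.sub continuous_id).tendsto 1
        rw [sub_self] at this
        exact this.mono_left nhdsWithin_le_nhds
      refine (hc.tendsto.comp hsub).neg.congr' ?_
      filter_upwards [hsub hball, self_mem_nhdsWithin] with z hz hz1
      have h0 : 1 - z ≠ 0 := sub_ne_zero.mpr (Ne.symm hz1)
      have h1 := hf (1 - z) hz
      rw [sub_sub_cancel, ← neg_sub, inv_neg, neg_mul,
        inv_mul_interpolant hp2 (he hs) hz h0] at h1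
      exact h1.symm
    obtain ⟨h1, h2⟩ := extendAtOne_of_tendsto hlim
    refine ⟨?_, fun _ ↦ h2⟩
    rw [hs, map_zero, sub_zero, h1, interpolantQuotient_zero]
  · have hs0 : (intEmb s : ℂ_[p]) ≠ 0 := by
      rw [← norm_ne_zero_iff, norm_intEmb, norm_ne_zero_iff]
      exact hs
    refine ⟨?_, fun h ↦ (hs h).elim⟩
    rw [extendAtOne_of_ne _ (by simpa [sub_eq_self] using hs0), hf _ (norm_intEmb_le_one s),
      interpolantQuotient_of_ne_zero e hs0, sub_sub_cancel_left, inv_neg, neg_mul]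

theorem hurwitzZeta_one_sub (hp2 : p ≠ 2) {e : ℕ} {s : ℤ_[p]}
    (he : s = 0 → interpolant p e 0 = 0) :
    hurwitzZeta (1 - intEmb s) (omega p 0 ^ e) 0 = -interpolantQuotient p e (intEmb s) ∧
      (s = 0 → ContinuousAt (fun z : ℂ_[p] ↦ hurwitzZeta z (omega p 0 ^ e) 0) 1) :=
  extendAtOne_interpolant hp2
    (fun t ht ↦ by rw [volkenbornIntegral_hurwitzIntegrand hp2 e ht]) he

theorem padicL_one_sub (hp2 : p ≠ 2) {e : ℕ} {s : ℤ_[p]}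
    (he : s = 0 → interpolant p e 0 = 0) :
    padicL (1 - intEmb s) (omega p 0 ^ e) = -interpolantQuotient p e (intEmb s) ∧
      (s = 0 → ContinuousAt (fun z : ℂ_[p] ↦ padicL z (omega p 0 ^ e)) 1) :=
  extendAtOne_interpolant hp2 (fun t _ ↦ by rw [sub_sub_cancel]; rfl) he

end PadicEisenstein

end

open PadicEisenstein in
theorem proposition2p3 (p : ℕ) [Fact p.Prime] (hp : p ≠ 2) (s : ℤ_[p]) (u : ZMod (p - 1))
    (hu : Even u) (hsu : ¬(s = 0 ∧ u = 0)) :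
    -- the constant terms agree, and both are `½ L_p(1 - s, ω ^ u)`
    constantTerm (algebraMap ℚ_[p] ℂ_[p] s) (omega p 0 ^ u.val) 0 =
        algebraMap ℚ_[p] ℂ_[p] (PowerSeries.coeff 0 (padicEisenstein s u)) ∧
      algebraMap ℚ_[p] ℂ_[p] (PowerSeries.coeff 0 (padicEisenstein s u)) =
        1 / 2 * padicL (1 - algebraMap ℚ_[p] ℂ_[p] s) (omega p 0 ^ u.val) ∧
      -- the limit defining the constant term of `G*_{s,u}` exists
      Tendsto (fun k : ℕ ↦ ((PowerSeries.coeff 0 (eisensteinQExp k) : ℚ) : ℚ_[p]))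
        (weightFilter s u) (𝓝 (PowerSeries.coeff 0 (padicEisenstein s u))) ∧
      -- for `s ≠ 0` the series and the integral defining the two functions at `1 - s` converge
      (s ≠ 0 →
        (∀ a : ℤ_[p], a ≠ 0 → Summable (anglePowTerm a (algebraMap ℚ_[p] ℂ_[p] s))) ∧
        Tendsto
          (volkenbornSum (hurwitzIntegrand (1 - algebraMap ℚ_[p] ℂ_[p] s) (omega p 0 ^ u.val) 0))
          atTop
          (𝓝 (volkenbornIntegral
            (hurwitzIntegrand (1 - algebraMap ℚ_[p] ℂ_[p] s) (omega p 0 ^ u.val) 0))) ∧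
        Summable (interpolationTerm (omega p 0 ^ u.val) (algebraMap ℚ_[p] ℂ_[p] s))) ∧
      -- for `s = 0` the limits defining the two functions at `1` exist
      (s = 0 →
        ContinuousAt (fun z : ℂ_[p] ↦ hurwitzZeta z (omega p 0 ^ u.val) 0) 1 ∧
        ContinuousAt (fun z : ℂ_[p] ↦ padicL z (omega p 0 ^ u.val)) 1) := by
  have h2 := Nat.Prime.two_le (Fact.out : p.Prime)
  have hne : NeZero (p - 1) := ⟨by omega⟩
  have he : s = 0 → interpolant p u.val 0 = 0 := by
    refine fun hs ↦ interpolant_zero fun hdvd ↦ hsu ⟨hs, ?_⟩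
    rw [← ZMod.natCast_zmod_val u, ZMod.natCast_eq_zero_iff]
    exact hdvd
  obtain ⟨hG, hlim⟩ := coeff_zero_padicEisenstein hp hu (ZMod.natCast_zmod_val u) he
  obtain ⟨hζ, hζc⟩ := hurwitzZeta_one_sub hp he
  obtain ⟨hL, hLc⟩ := padicL_one_sub hp he
  have hs1 : ‖algebraMap ℚ_[p] ℂ_[p] s‖ ≤ 1 := norm_intEmb_le_one s
  rw [intEmb_apply] at hζ hL hG
  refine ⟨?_, ?_, hlim, fun _ ↦ ⟨fun a ha ↦ summable_anglePowTerm hp ha hs1, ?_,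
    summable_interpolationTerm hp _ hs1⟩, fun hs ↦ ⟨hζc hs, hLc hs⟩⟩
  · rw [constantTerm, hζ, hG]
    ring
  · rw [hG, hL]
    ring
  · rw [volkenbornIntegral_hurwitzIntegrand hp _ hs1]
    exact tendsto_volkenbornSum_hurwitzIntegrand hp _ hs1
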